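/- An integer partition is a finite multiset of positive integers (its parts); its size is the sum of its parts. For integers $a,b,m\ge 1$, an $(a,b,m)$-copartition is a triple $(\gamma,\rho,\sigma)$ of integer partitions such that every part of $\gamma$ is at least $a$ and congruent to $a$ modulo $m$, every part of $\sigma$ is at least $b$ and congruent to $b$ modulo $m$, and $\rho$ has the same number of parts as $\sigma$, each of them equal to $m$ times the number of parts of $\gamma$ (if $\gamma$ is empty, these parts are $0$ and $\rho$ is understood to be the empty partition). The size of $(\gamma,\rho,\sigma)$ is the sum of the sizes of $\gamma$, $\rho$ and $\sigma$, and $\mathrm{cp}_{a,b,m}(n)$ denotes the number of $(a,b,m)$-copartitions of size $n$. **Theorem.** The set of positive integers at which $\mathrm{cp}_{3,1,4}$ is even has natural density $1$, that is, $$\lim_{n\to\infty}\frac{\#\{1\le k\le n \mid \mathrm{cp}_{3,1,4}(k)\text{ is even}\}}{n}=1.$$ Moreover, for every integer $n\ge 0$, if some prime $p\equiv 3\pmod 4$ occurs with an odd exponent in the prime factorization of $24n+5$, then $\mathrm{cp}_{3,1,4}(n)$ is even. -/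

import Mathlib

open Filter Topology

/-- An integer partition of unspecified size: `l.1` is its size `|l|` and
`l.2.parts` the multiset of its (positive) parts. -/
abbrev IntPartition : Type := Σ k : ℕ, k.Partition

/-- An `(a, b, m)`-copartition `(γ, ρ, σ)`: `ground` is `γ`, `rect` is `ρ`, `sky` is `σ`.
The parts of `ρ` are `card σ` copies of `m * card γ`. If `γ` is empty these copies are zeros;
a partition has no zero parts, so then `rect_parts` makes `ρ` the empty partition. -/
@[ext]
structure Copartition (a b m : ℕ) where
  ground : IntPartition
  rect : IntPartition
  sky : IntPartition
  ground_parts : ∀ x ∈ ground.2.parts, a ≤ x ∧ x ≡ a [MOD m]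
  sky_parts : ∀ x ∈ sky.2.parts, b ≤ x ∧ x ≡ b [MOD m]
  rect_parts : ∀ x ∈ rect.2.parts, x = m * ground.2.parts.card
  rect_card : ground.2.parts.card ≠ 0 → rect.2.parts.card = sky.2.parts.card

/-- The size `|γ| + |ρ| + |σ|` of a copartition. -/
def Copartition.size {a b m : ℕ} (c : Copartition a b m) : ℕ :=
  c.ground.1 + c.rect.1 + c.sky.1

/-- There are only finitely many copartitions of a given size, so that counting them with
`Set.ncard` is meaningful. -/
theorem Copartition.finite_size_eq (a b m n : ℕ) :
    {c : Copartition a b m | c.size = n}.Finite := by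
  have hS : {l : IntPartition | l.1 ≤ n}.Finite := by
    have h : {l : IntPartition | l.1 ≤ n} ⊆
        ⋃ k ∈ Set.Iic n, Set.range (fun p : k.Partition => (⟨k, p⟩ : IntPartition)) := by
      rintro ⟨k, p⟩ hk
      simp only [Set.mem_iUnion]
      exact ⟨k, hk, p, rfl⟩
    exact ((Set.finite_Iic n).biUnion fun k _ => Set.finite_range _).subset h
  refine Set.Finite.of_finite_image (f := fun c => (c.ground, c.rect, c.sky))
    ((hS.prod (hS.prod hS)).subset ?_) ?_
  · rintro _ ⟨c, hc, rfl⟩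
    have hc' : c.ground.1 + c.rect.1 + c.sky.1 = n := hc
    refine ⟨?_, ?_, ?_⟩ <;> simp only [Set.mem_ofPred_eq] <;> omega
  · intro c _ d _ h
    simp only [Prod.mk.injEq] at h
    exact Copartition.ext h.1 h.2.1 h.2.2

/-- `cp a b m n` is the number of `(a, b, m)`-copartitions of size `n` (used for
`a, b, m ≥ 1`). -/
noncomputable def cp (a b m n : ℕ) : ℕ :=
  {c : Copartition a b m | c.size = n}.ncard

/-! Write G(a,b) for the generating function of `cp a b 4`. Splitting by whether `a` is a part of
the ground, and using the symmetry in a and b, gives (1 - q^a) G(a,b) = (1 - q^(a+b)) G(a+4,b).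
Iterated from (3,1), this yields G(3,1) = ∏(1 - q^(4i)) / ∏(1 - q^(2i-1)). Modulo 2 the reciprocal
of ∏(1 - q^(2i-1)) is ∏(1 - q^i), so G(3,1) ≡ ∏(1 - q^i) ∏(1 - q^(4i)).

By the pentagonal number theorem an odd value at n forces n = P(k) + 4 P(l) with P pentagonal, hence
24n + 5 = (6k - 1)² + (2(6l - 1))². A sum of two squares contains each prime p ≡ 3 mod 4 to an even
power, which is the second claim.

For the density, an odd value at n means that no such p divides 24n + 5 exactly once. Each p > 3
excludes p - 1 residues modulo p². The Chinese remainder theorem and the divergence of ∑ 1/p over p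
≡ 3 mod 4 make the remaining density 0. -/

/-! ### Copartitions as pairs of index multisets -/

/-- The size of the copartition with ground `{a + m * i | i ∈ μ}` and sky
`{b + m * j | j ∈ ν}`. -/
def shiftedSize (a b m : ℕ) (p : Multiset ℕ × Multiset ℕ) : ℕ :=
  a * p.1.card + b * p.2.card + m * (p.1.sum + p.2.sum + p.1.card * p.2.card)

theorem IntPartition.ext_parts {p q : IntPartition} (h : p.2.parts = q.2.parts) : p = q := by
  obtain ⟨k, p⟩ := p
  obtain ⟨l, q⟩ := q
  obtain rfl : k = l := by rw [← p.parts_sum, ← q.parts_sum]; exact congrArg _ h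
  exact Sigma.ext rfl (heq_of_eq (Nat.Partition.ext h))

/-- The integer partition with a given multiset of positive parts. -/
def IntPartition.ofParts (s : Multiset ℕ) (hs : ∀ x ∈ s, 0 < x) : IntPartition :=
  ⟨s.sum, s, fun {i} hi => hs i hi, rfl⟩

/-- The copartition whose ground and sky are given by shifted indices. -/
def Copartition.ofIndices {a b m : ℕ} (ha : 0 < a) (hb : 0 < b) (hm : 0 < m)
    (p : Multiset ℕ × Multiset ℕ) : Copartition a b m where
  ground := IntPartition.ofParts (p.1.map fun i => a + m * i) (by
    intro x hx; obtain ⟨i, -, rfl⟩ := Multiset.mem_map.mp hx; omega)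
  rect := IntPartition.ofParts
    (if p.1.card = 0 then 0 else Multiset.replicate p.2.card (m * p.1.card)) (by
      intro x hx
      split_ifs at hx with h
      · simp at hx
      · rw [Multiset.eq_of_mem_replicate hx]; exact Nat.mul_pos hm (Nat.pos_of_ne_zero h))
  sky := IntPartition.ofParts (p.2.map fun i => b + m * i) (by
    intro x hx; obtain ⟨i, -, rfl⟩ := Multiset.mem_map.mp hx; omega)
  ground_parts := by
    intro x hx
    obtain ⟨i, -, rfl⟩ := Multiset.mem_map.mp hx
    exact ⟨by omega, by simp [Nat.ModEq]⟩
  sky_parts := by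
    intro x hx
    obtain ⟨i, -, rfl⟩ := Multiset.mem_map.mp hx
    exact ⟨by omega, by simp [Nat.ModEq]⟩
  rect_parts := by
    intro x hx
    simp only [IntPartition.ofParts, Multiset.card_map] at hx ⊢
    split_ifs at hx with h
    · simp at hx
    · exact Multiset.eq_of_mem_replicate hx
  rect_card := by
    simp only [IntPartition.ofParts, Multiset.card_map]
    intro h
    simp [h]

theorem Multiset.sum_map_add_mul (a m : ℕ) (s : Multiset ℕ) :
    (s.map fun i => a + m * i).sum = a * s.card + m * s.sum := by
  rw [Multiset.sum_map_add, Multiset.map_const', Multiset.sum_replicate, Multiset.sum_map_mul_left,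
    Multiset.map_id', smul_eq_mul, mul_comm]

theorem Copartition.size_ofIndices {a b m : ℕ} (ha : 0 < a) (hb : 0 < b) (hm : 0 < m)
    (p : Multiset ℕ × Multiset ℕ) :
    (Copartition.ofIndices ha hb hm p).size = shiftedSize a b m p := by
  simp only [Copartition.size, Copartition.ofIndices, IntPartition.ofParts,
    Multiset.sum_map_add_mul, shiftedSize]
  split_ifs with h
  · simp [h]; ring
  · simp; ring

theorem Copartition.ofIndices_injective {a b m : ℕ} (ha : 0 < a) (hb : 0 < b) (hm : 0 < m) :
    Function.Injective (Copartition.ofIndices ha hb hm) := by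
  rintro ⟨μ, ν⟩ ⟨μ', ν'⟩ h
  have hinj (c : ℕ) : Function.Injective fun i => c + m * i := by
    intro i j hij
    exact Nat.eq_of_mul_eq_mul_left hm (Nat.add_left_cancel hij)
  have h1 : μ.map (fun i => a + m * i) = μ'.map (fun i => a + m * i) :=
    congrArg (fun c => c.ground.2.parts) h
  have h2 : ν.map (fun i => b + m * i) = ν'.map (fun i => b + m * i) :=
    congrArg (fun c => c.sky.2.parts) h
  rw [Multiset.map_injective (hinj a) h1, Multiset.map_injective (hinj b) h2]

theorem Multiset.exists_map_add_mul {a m : ℕ} (s : Multiset ℕ)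
    (hs : ∀ x ∈ s, a ≤ x ∧ x ≡ a [MOD m]) : ∃ t : Multiset ℕ, t.map (fun i => a + m * i) = s := by
  refine ⟨s.map fun x => (x - a) / m, ?_⟩
  rw [Multiset.map_map]
  conv_rhs => rw [← Multiset.map_id s]
  refine Multiset.map_congr rfl fun x hx => ?_
  obtain ⟨h1, h2⟩ := hs x hx
  have := Nat.mul_div_cancel' ((Nat.modEq_iff_dvd' h1).mp h2.symm)
  simp only [Function.comp, id]
  omega

theorem Copartition.ofIndices_surjective {a b m : ℕ} (ha : 0 < a) (hb : 0 < b) (hm : 0 < m) :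
    Function.Surjective (Copartition.ofIndices ha hb hm) := by
  intro c
  obtain ⟨μ, hμ⟩ := Multiset.exists_map_add_mul _ c.ground_parts
  obtain ⟨ν, hν⟩ := Multiset.exists_map_add_mul _ c.sky_parts
  refine ⟨(μ, ν), Copartition.ext (IntPartition.ext_parts hμ) (IntPartition.ext_parts ?_)
    (IntPartition.ext_parts hν)⟩
  have h1 : c.ground.2.parts.card = μ.card := by rw [← hμ, Multiset.card_map]
  have h2 : c.sky.2.parts.card = ν.card := by rw [← hν, Multiset.card_map]
  simp only [Copartition.ofIndices, IntPartition.ofParts]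
  split_ifs with h
  -- With an empty ground, `rect_card` says nothing; a part of ρ would equal m * 0, contradicting
  -- positivity.
  · refine (Multiset.eq_zero_of_forall_notMem fun x hx => ?_).symm
    have h3 := c.rect_parts x hx
    have h4 := c.rect.2.parts_pos hx
    rw [h1, h, mul_zero] at h3
    omega
  · refine (Multiset.eq_replicate.mpr ⟨?_, fun x hx => ?_⟩).symm
    · rw [c.rect_card (by rwa [h1]), h2]
    · rw [c.rect_parts x hx, h1]

theorem image_ofIndices {a b m : ℕ} (ha : 0 < a) (hb : 0 < b) (hm : 0 < m) (n : ℕ) :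
    Copartition.ofIndices ha hb hm '' {p | shiftedSize a b m p = n} =
      {c : Copartition a b m | c.size = n} := by
  ext c
  obtain ⟨p, rfl⟩ := Copartition.ofIndices_surjective ha hb hm c
  simp only [(Copartition.ofIndices_injective ha hb hm).mem_set_image, Set.mem_ofPred_eq,
    Copartition.size_ofIndices]

theorem cp_eq_ncard {a b m : ℕ} (ha : 0 < a) (hb : 0 < b) (hm : 0 < m) (n : ℕ) :
    cp a b m n = {p | shiftedSize a b m p = n}.ncard := by
  rw [cp, ← image_ofIndices ha hb hm,
    Set.ncard_image_of_injective _ (Copartition.ofIndices_injective ha hb hm)]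

theorem finite_shiftedSize_eq {a b m : ℕ} (ha : 0 < a) (hb : 0 < b) (hm : 0 < m) (n : ℕ) :
    {p | shiftedSize a b m p = n}.Finite := by
  refine Set.Finite.of_finite_image ?_ (Copartition.ofIndices_injective ha hb hm).injOn
  rw [image_ofIndices]
  exact Copartition.finite_size_eq a b m n

theorem cp_comm {a b m : ℕ} (ha : 0 < a) (hb : 0 < b) (hm : 0 < m) (n : ℕ) :
    cp a b m n = cp b a m n := by
  rw [cp_eq_ncard ha hb hm, cp_eq_ncard hb ha hm,
    ← Set.ncard_image_of_injective _ Prod.swap_injective]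
  congr 1
  ext p
  rw [Set.image_swap_eq_preimage_swap]
  simp only [Set.mem_preimage, Set.mem_ofPred_eq, shiftedSize, Prod.fst_swap, Prod.snd_swap]
  rw [add_comm (b * _), add_comm p.1.sum, mul_comm p.1.card]

/-! ### Recurrence and initial values -/

theorem shiftedSize_map_succ (a b m : ℕ) (p : Multiset ℕ × Multiset ℕ) :
    shiftedSize a b m (p.1.map Nat.succ, p.2) = shiftedSize (a + m) b m p := by
  have h : (p.1.map Nat.succ).sum = p.1.sum + p.1.card := by
    simp [Nat.succ_eq_add_one, Multiset.sum_map_add]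
  simp only [shiftedSize, Multiset.card_map, h]
  ring

/-- Removing a part `a` from the ground takes `m` off the rectangle for each part of the sky;
raising `b` to `b + m` restores it. -/
theorem shiftedSize_cons_zero (a b m : ℕ) (p : Multiset ℕ × Multiset ℕ) :
    shiftedSize a b m (0 ::ₘ p.1, p.2) = a + shiftedSize a (b + m) m p := by
  simp only [shiftedSize, Multiset.card_cons, Multiset.sum_cons]
  ring

theorem Multiset.exists_map_succ {s : Multiset ℕ} (hs : 0 ∉ s) :
    ∃ t : Multiset ℕ, t.map Nat.succ = s := by
  refine ⟨s.map Nat.pred, ?_⟩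
  rw [Multiset.map_map]
  conv_rhs => rw [← Multiset.map_id s]
  refine Multiset.map_congr rfl fun x hx => ?_
  exact Nat.succ_pred_eq_of_ne_zero fun h => hs (h ▸ hx)

/-- Copartitions split according to whether `a` is a part of the ground. -/
theorem cp_eq_add {a b m : ℕ} (ha : 0 < a) (hb : 0 < b) (hm : 0 < m) (n : ℕ) :
    cp a b m n = cp (a + m) b m n + if a ≤ n then cp a (b + m) m (n - a) else 0 := by
  let f : Multiset ℕ × Multiset ℕ → Multiset ℕ × Multiset ℕ := fun p => (p.1.map Nat.succ, p.2)
  let g : Multiset ℕ × Multiset ℕ → Multiset ℕ × Multiset ℕ := fun p => (0 ::ₘ p.1, p.2)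
  have hf : Function.Injective f := by
    rintro ⟨μ, ν⟩ ⟨μ', ν'⟩ h
    simp only [f, Prod.mk.injEq] at h
    rw [Multiset.map_injective Nat.succ_injective h.1, h.2]
  have hg : Function.Injective g := by
    rintro ⟨μ, ν⟩ ⟨μ', ν'⟩ h
    simp only [g, Prod.mk.injEq, Multiset.cons_inj_right] at h
    rw [h.1, h.2]
  have hfin := finite_shiftedSize_eq ha hb hm n
  have hset : {p | shiftedSize a b m p = n} =
      f '' {p | shiftedSize (a + m) b m p = n} ∪ g '' {p | a + shiftedSize a (b + m) m p = n} := by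
    ext ⟨μ, ν⟩
    constructor
    · intro h
      by_cases h0 : 0 ∈ μ
      · obtain ⟨μ', rfl⟩ := Multiset.exists_cons_of_mem h0
        exact Or.inr ⟨(μ', ν), (shiftedSize_cons_zero a b m (μ', ν)).symm.trans h, rfl⟩
      · obtain ⟨μ', rfl⟩ := Multiset.exists_map_succ h0
        exact Or.inl ⟨(μ', ν), (shiftedSize_map_succ a b m (μ', ν)).symm.trans h, rfl⟩
    · rintro (⟨p, hp, hp'⟩ | ⟨p, hp, hp'⟩)
      · rw [← hp']; exact (shiftedSize_map_succ a b m p).trans hp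
      · rw [← hp']; exact (shiftedSize_cons_zero a b m p).trans hp
  have hdisj : Disjoint (f '' {p | shiftedSize (a + m) b m p = n})
      (g '' {p | a + shiftedSize a (b + m) m p = n}) := by
    rw [Set.disjoint_left]
    rintro _ ⟨p, -, rfl⟩ ⟨q, -, h⟩
    have h1 : 0 ∈ (f p).1 := by rw [← h]; exact Multiset.mem_cons_self 0 _
    simp [f] at h1
  rw [cp_eq_ncard ha hb hm, cp_eq_ncard (by omega) hb hm, cp_eq_ncard ha (by omega) hm]
  rw [hset] at hfin
  rw [hset, Set.ncard_union_eq hdisj (hfin.subset Set.subset_union_left)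
    (hfin.subset Set.subset_union_right), Set.ncard_image_of_injective _ hf,
    Set.ncard_image_of_injective _ hg]
  congr 1
  split_ifs with h
  · congr 1
    ext p
    simp only [Set.mem_ofPred_eq]
    omega
  · rw [Set.ncard_eq_zero (Set.Finite.subset (Set.finite_empty) fun p hp => by
      simp only [Set.mem_ofPred_eq] at hp; omega)]
    ext p
    simp only [Set.mem_ofPred_eq, Set.mem_empty_iff_false, iff_false]
    omega

theorem cp_zero {a b m : ℕ} (ha : 0 < a) (hb : 0 < b) (hm : 0 < m) : cp a b m 0 = 1 := by
  rw [cp_eq_ncard ha hb hm, Set.ncard_eq_one]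
  refine ⟨(0, 0), Set.ext fun ⟨μ, ν⟩ => ?_⟩
  simp only [Set.mem_ofPred_eq, Set.mem_singleton_iff, Prod.mk.injEq, shiftedSize]
  constructor
  · intro h
    simp only [Nat.add_eq_zero_iff, mul_eq_zero, ha.ne', hb.ne', false_or,
      Multiset.card_eq_zero] at h
    exact h.1
  · rintro ⟨rfl, rfl⟩
    simp

theorem cp_eq_zero_of_lt {a b m n : ℕ} (hm : 0 < m) (hn : 0 < n) (hna : n < a) (hnb : n < b) :
    cp a b m n = 0 := by
  rw [cp_eq_ncard (by omega) (by omega) hm, Set.ncard_eq_zero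
    (finite_shiftedSize_eq (by omega) (by omega) hm n)]
  refine Set.eq_empty_of_forall_notMem fun ⟨μ, ν⟩ h => ?_
  simp only [Set.mem_ofPred_eq, shiftedSize] at h
  rcases Nat.eq_zero_or_pos μ.card with hμ | hμ
  · rcases Nat.eq_zero_or_pos ν.card with hν | hν
    · rw [Multiset.card_eq_zero] at hμ hν
      subst hμ hν
      simp at h
      omega
    · have := Nat.le_mul_of_pos_right b hν
      omega
  · have := Nat.le_mul_of_pos_right a hμ
    omega

/-! ### Product formula and its reduction modulo 2 -/

/-- The generating function of `cp a b m`. -/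
noncomputable def cpSeries (R : Type*) [CommRing R] (a b m : ℕ) : PowerSeries R :=
  PowerSeries.mk fun n => (cp a b m n : R)

section CpSeries

open PowerSeries

variable (R : Type*) [CommRing R]

theorem cpSeries_comm {a b m : ℕ} (ha : 0 < a) (hb : 0 < b) (hm : 0 < m) :
    cpSeries R a b m = cpSeries R b a m := by
  ext n
  simp only [cpSeries, coeff_mk, cp_comm ha hb hm]

theorem cpSeries_eq_add {a b m : ℕ} (ha : 0 < a) (hb : 0 < b) (hm : 0 < m) :
    cpSeries R a b m = cpSeries R (a + m) b m + X ^ a * cpSeries R a (b + m) m := by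
  ext n
  rw [map_add, coeff_X_pow_mul']
  simp only [cpSeries, coeff_mk]
  rw [cp_eq_add ha hb hm]
  split_ifs <;> push_cast <;> rfl

/-- The recurrence and its mirror image under a ↔ b involve the same two shifted series; this
eliminates the one with `b + m`. -/
theorem one_sub_X_pow_mul_cpSeries {a b m : ℕ} (ha : 0 < a) (hb : 0 < b) (hm : 0 < m) :
    (1 - X ^ a) * cpSeries R a b m = (1 - X ^ (a + b)) * cpSeries R (a + m) b m := by
  have h1 := cpSeries_eq_add R ha hb hm
  have h2 := cpSeries_eq_add R hb ha hm
  rw [cpSeries_comm R hb ha hm, cpSeries_comm R (by omega) ha hm,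
    cpSeries_comm R hb (by omega) hm] at h2
  linear_combination h1 - X ^ a * h2

theorem one_sub_X_pow_mul_one_sub_X_pow_mul_cpSeries {a b m : ℕ} (ha : 0 < a) (hb : 0 < b)
    (hm : 0 < m) :
    (1 - X ^ a) * (1 - X ^ b) * cpSeries R a b m =
      (1 - X ^ (a + b)) * (1 - X ^ (a + b + m)) * cpSeries R (a + m) (b + m) m := by
  have h1 := one_sub_X_pow_mul_cpSeries R ha hb hm
  have h2 := one_sub_X_pow_mul_cpSeries R hb (show 0 < a + m by omega) hm
  rw [cpSeries_comm R hb (show 0 < a + m by omega) hm,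
    cpSeries_comm R (show 0 < b + m by omega) (show 0 < a + m by omega) hm,
    show b + (a + m) = a + b + m by ring] at h2
  linear_combination (1 - X ^ b) * h1 + (1 - X ^ (a + b)) * h2

theorem X_pow_dvd_cpSeries_sub_one {a b m k : ℕ} (ha : 0 < a) (hb : 0 < b) (hm : 0 < m)
    (hka : k ≤ a) (hkb : k ≤ b) : X ^ k ∣ cpSeries R a b m - 1 := by
  rw [X_pow_dvd_iff]
  intro n hn
  rw [map_sub, cpSeries, coeff_mk, coeff_one]
  rcases Nat.eq_zero_or_pos n with rfl | h
  · simp [cp_zero ha hb hm]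
  · simp [cp_eq_zero_of_lt hm h (hn.trans_le hka) (hn.trans_le hkb), h.ne']

/-- Each step raises both 3 + 4J and 1 + 4J by 4: these are the next two odd exponents, and their
sum 8J + 4 and that sum plus 4 are the next two multiples of 4. -/
theorem prod_odd_mul_cpSeries (J : ℕ) :
    (∏ i ∈ Finset.range (2 * J), (1 - X ^ (2 * i + 1))) * cpSeries R 3 1 4 =
      (∏ i ∈ Finset.range (2 * J), (1 - X ^ (4 * (i + 1)))) *
        cpSeries R (3 + 4 * J) (1 + 4 * J) 4 := by
  induction J with
  | zero => simp
  | succ J ih =>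
    have h := one_sub_X_pow_mul_one_sub_X_pow_mul_cpSeries R (a := 3 + 4 * J) (b := 1 + 4 * J)
      (m := 4) (by omega) (by omega) (by omega)
    rw [show 2 * (J + 1) = 2 * J + 1 + 1 by ring]
    simp only [Finset.prod_range_succ]
    rw [show 3 + 4 * (J + 1) = 3 + 4 * J + 4 by ring, show 1 + 4 * (J + 1) = 1 + 4 * J + 4 by ring,
      show 2 * (2 * J) + 1 = 1 + 4 * J by ring, show 2 * (2 * J + 1) + 1 = 3 + 4 * J by ring,
      show 4 * (2 * J + 1) = 3 + 4 * J + (1 + 4 * J) by ring,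
      show 4 * (2 * J + 1 + 1) = 3 + 4 * J + (1 + 4 * J) + 4 by ring]
    linear_combination (1 - X ^ (1 + 4 * J)) * (1 - X ^ (3 + 4 * J)) * ih +
      (∏ i ∈ Finset.range (2 * J), (1 - X ^ (4 * (i + 1)))) * h

/-- The partial products of the Euler function agree to increasing order. -/
theorem X_pow_dvd_prod_sub_prod (j k : ℕ) :
    (X ^ j : PowerSeries R) ∣ (∏ i ∈ Finset.range (j + k), (1 - X ^ (i + 1))) -
      ∏ i ∈ Finset.range j, (1 - X ^ (i + 1)) := by
  induction k with
  | zero => simp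
  | succ k ih =>
    rw [← add_assoc, Finset.prod_range_succ]
    have h : (X ^ j : PowerSeries R) ∣ X ^ (j + k + 1) := pow_dvd_pow X (by omega)
    have := dvd_sub ih (h.mul_left (∏ i ∈ Finset.range (j + k), (1 - X ^ (i + 1))))
    convert this using 1
    ring

theorem prod_range_two_mul (f : ℕ → PowerSeries R) (k : ℕ) :
    ∏ i ∈ Finset.range (2 * k), f (i + 1) =
      (∏ i ∈ Finset.range k, f (2 * i + 1)) * ∏ i ∈ Finset.range k, f (2 * (i + 1)) := by
  induction k with
  | zero => simp
  | succ k ih =>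
    rw [show 2 * (k + 1) = 2 * k + 1 + 1 by ring]
    simp only [Finset.prod_range_succ, ih]
    rw [show 2 * (k + 1) = 2 * k + 1 + 1 by ring]
    ring

theorem isUnit_prod_one_sub_X_pow (k : ℕ) :
    IsUnit (∏ i ∈ Finset.range k, (1 - X ^ (i + 1)) : PowerSeries R) := by
  rw [isUnit_iff_constantCoeff, map_prod]
  simp

/-- Modulo `2`, the Euler function is inverse to `∏ (1 - X ^ (2 * i + 1))`. -/
theorem X_pow_dvd_prod_odd_mul_prod_sub_one (k : ℕ) :
    (X ^ k : PowerSeries (ZMod 2)) ∣ (∏ i ∈ Finset.range k, (1 - X ^ (2 * i + 1))) *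
      (∏ i ∈ Finset.range k, (1 - X ^ (i + 1))) - 1 := by
  set Q : PowerSeries (ZMod 2) := ∏ i ∈ Finset.range k, (1 - X ^ (i + 1)) with hQ
  have hsq : ∏ i ∈ Finset.range k, (1 - X ^ (2 * (i + 1)) : PowerSeries (ZMod 2)) = Q ^ 2 := by
    rw [hQ, ← Finset.prod_pow]
    refine Finset.prod_congr rfl fun i _ => ?_
    have h2 : (2 : PowerSeries (ZMod 2)) = 0 := by
      have : (2 : ZMod 2) = 0 := rfl
      rw [← map_ofNat (C (R := ZMod 2)) 2]
      simp [this]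
    linear_combination (X ^ (i + 1) - X ^ (2 * (i + 1))) * h2
  have h1 := X_pow_dvd_prod_sub_prod (ZMod 2) k k
  rw [← two_mul, prod_range_two_mul (ZMod 2) (fun i => 1 - X ^ i), hsq, ← hQ] at h1
  -- `h1` now says that the odd product times Q² agrees with Q up to X^k; one factor Q is cancelled
  -- as a unit.
  refine (isUnit_prod_one_sub_X_pow (ZMod 2) k).dvd_mul_left.mp ?_
  rw [← hQ]
  convert h1 using 1
  ring

/-- Multiplying `prod_odd_mul_cpSeries` by the truncated Euler product makes the odd factors 1 up to
X^(2J), and the leftover series is 1 to that order as well. -/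
theorem X_pow_dvd_cpSeries_sub (J : ℕ) :
    X ^ (2 * J) ∣ cpSeries (ZMod 2) 3 1 4 -
      (∏ i ∈ Finset.range (2 * J), (1 - X ^ (i + 1))) *
        ∏ i ∈ Finset.range (2 * J), (1 - X ^ (4 * (i + 1))) := by
  have h1 := prod_odd_mul_cpSeries (ZMod 2) J
  have h2 := X_pow_dvd_prod_odd_mul_prod_sub_one (2 * J)
  have h3 := X_pow_dvd_cpSeries_sub_one (ZMod 2) (a := 3 + 4 * J) (b := 1 + 4 * J) (m := 4)
    (k := 2 * J) (by omega) (by omega) (by omega) (by omega) (by omega)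
  generalize (∏ i ∈ Finset.range (2 * J), (1 - X ^ (2 * i + 1)) : PowerSeries (ZMod 2)) = O at *
  generalize (∏ i ∈ Finset.range (2 * J), (1 - X ^ (i + 1)) : PowerSeries (ZMod 2)) = Q at *
  generalize (∏ i ∈ Finset.range (2 * J), (1 - X ^ (4 * (i + 1))) : PowerSeries (ZMod 2)) = E at *
  have h4 := dvd_sub (h3.mul_left (Q * E)) (h2.mul_left (cpSeries (ZMod 2) 3 1 4))
  convert h4 using 1
  linear_combination Q * h1

theorem coe_expand_prod (k : ℕ) :
    ((Polynomial.expand R 4 (∏ i ∈ Finset.range k, (1 - Polynomial.X ^ (i + 1))) :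
      Polynomial R) : PowerSeries R) = ∏ i ∈ Finset.range k, (1 - X ^ (4 * (i + 1))) := by
  rw [map_prod, ← Polynomial.coeToPowerSeries.ringHom_apply, map_prod]
  simp [← pow_mul]

theorem coe_prod_one_sub_X_pow (k : ℕ) :
    ((∏ i ∈ Finset.range k, (1 - Polynomial.X ^ (i + 1)) : Polynomial R) : PowerSeries R) =
      ∏ i ∈ Finset.range k, (1 - X ^ (i + 1)) := by
  rw [← Polynomial.coeToPowerSeries.ringHom_apply, map_prod]
  simp

theorem exists_pentagonal_of_odd_cp {n : ℕ} (hn : Odd (cp 3 1 4 n)) :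
    ∃ k l : ℤ, n = pentagonal k + 4 * pentagonal l := by
  have hev : ∀ᶠ k in atTop, ∀ i ∈ Finset.range (n + 1),
      (∏ j ∈ Finset.range k, (1 - X ^ (j + 1) : PowerSeries (ZMod 2))).coeff i =
        (pentagonalSeries (ZMod 2)).coeff i :=
    (Finset.eventually_all _).mpr fun i _ =>
      tendsto_finset_range.eventually (coeff_prod_one_sub_X_pow_eventually_eq (ZMod 2) i)
  obtain ⟨K, hK⟩ := eventually_atTop.mp hev
  -- J ≥ K makes the coefficients up to n stable, and J > n puts n below the truncation order 2J.
  set J := max K (n + 1) with hJ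
  have hcoeff := hK (2 * J) (by omega)
  have hpent : ∀ i ≤ n,
      (∏ j ∈ Finset.range (2 * J), (1 - X ^ (j + 1) : PowerSeries (ZMod 2))).coeff i ≠ 0 →
      ∃ k : ℤ, pentagonal k = i := by
    intro i hi h
    rw [hcoeff i (by simp; omega)] at h
    by_contra hne
    exact h (coeff_pentagonalSeries_eq_zero _ hne)
  have h0 : coeff n (cpSeries (ZMod 2) 3 1 4) ≠ 0 := by
    rw [cpSeries, coeff_mk, (ZMod.natCast_eq_one_iff_odd).mpr hn]
    exact one_ne_zero
  have h1 := X_pow_dvd_iff.mp (X_pow_dvd_cpSeries_sub J) n (by omega)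
  rw [map_sub, sub_eq_zero] at h1
  rw [h1, coeff_mul] at h0
  obtain ⟨⟨i, j⟩, hij, hne⟩ := Finset.exists_ne_zero_of_sum_ne_zero h0
  rw [Finset.HasAntidiagonal.mem_antidiagonal] at hij
  simp only at hij hne
  obtain ⟨k, hk⟩ := hpent i (by omega) (left_ne_zero_of_mul hne)
  have hj := right_ne_zero_of_mul hne
  rw [← coe_expand_prod, Polynomial.coeff_coe, Polynomial.coeff_expand (by norm_num)] at hj
  split_ifs at hj with hd
  · rw [← Polynomial.coeff_coe, coe_prod_one_sub_X_pow] at hj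
    obtain ⟨l, hl⟩ := hpent (j / 4) (by omega) hj
    exact ⟨k, l, by omega⟩
  · exact absurd rfl hj

end CpSeries

/-! ### Sums of two squares -/

theorem exists_eq_sq_add_sq_of_odd_cp {n : ℕ} (hn : Odd (cp 3 1 4 n)) :
    ∃ x y : ℕ, 24 * n + 5 = x ^ 2 + y ^ 2 := by
  obtain ⟨k, l, h⟩ := exists_pentagonal_of_odd_cp hn
  refine ⟨(6 * k - 1).natAbs, (2 * (6 * l - 1)).natAbs, ?_⟩
  zify
  simp only [sq_abs]
  rw [h]
  push_cast
  linear_combination 12 * two_mul_natCast_pentagonal k + 48 * two_mul_natCast_pentagonal l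

theorem even_factorization_of_odd_cp {n p : ℕ} (hn : Odd (cp 3 1 4 n)) (hp : p.Prime)
    (hp4 : p % 4 = 3) : Even ((24 * n + 5).factorization p) := by
  by_cases hd : p ∣ 24 * n + 5
  · rw [Nat.factorization_def _ hp]
    exact Nat.eq_sq_add_sq_iff.mp (exists_eq_sq_add_sq_of_odd_cp hn) p
      (Nat.mem_primeFactors.mpr ⟨hp, hd, by omega⟩) hp4
  · rw [Nat.factorization_eq_zero_of_not_dvd hd]
    exact Even.zero

/-! ### Reciprocals of primes in a residue class -/

open ArithmeticFunction ArithmeticFunction.vonMangoldt in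
/-- The sum of the reciprocals of the primes in an invertible residue class diverges. -/
theorem not_summable_inv_primes_residueClass {q : ℕ} [NeZero q] {a : ZMod q} (ha : IsUnit a) :
    ¬ Summable ({p : ℕ | p.Prime ∧ (p : ZMod q) = a}.indicator fun p => (p : ℝ)⁻¹) := by
  intro hS
  obtain ⟨C, hC⟩ := LSeries_residueClass_lower_bound ha
  set A : ℕ → ℝ := fun n => (if n.Prime then 0 else residueClass a n) / n with hA
  have hAs : Summable A := summable_residueClass_non_primes_div a
  set B : ℕ → ℝ := {p : ℕ | p.Prime ∧ (p : ZMod q) = a}.indicator fun p => (p : ℝ)⁻¹ with hB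
  have hA0 (n : ℕ) : 0 ≤ A n := div_nonneg (by split_ifs; exacts [le_rfl, residueClass_nonneg a n])
    n.cast_nonneg
  have hB0 (n : ℕ) : 0 ≤ B n := Set.indicator_nonneg (fun _ _ => by positivity) _
  -- The factor x - 1 kills each term as x → 1⁺, and A + B is a summable bound under the assumption,
  -- so the sum tends to 0. The lower bound on the series keeps its limit at least 1/φ(q).
  have hlim : Tendsto (fun x : ℝ => ∑' n, (x - 1) * (residueClass a n / (n : ℝ) ^ x)) (𝓝[>] 1)
      (𝓝 (∑' _ : ℕ, (0 : ℝ))) := by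
    refine tendsto_tsum_of_dominated_convergence (bound := fun n => A n + B n) (hAs.add hS) ?_ ?_
    · intro n
      rcases Nat.eq_zero_or_pos n with rfl | hn
      · simp
      · have hn' : (n : ℝ) ≠ 0 := by positivity
        have hc : ContinuousAt (fun x : ℝ => (x - 1) * (residueClass a n / (n : ℝ) ^ x)) 1 := by
          refine ContinuousAt.mul (by fun_prop) (ContinuousAt.div continuousAt_const ?_ ?_)
          · exact Real.continuousAt_const_rpow hn'
          · simpa using hn'
        have := hc.tendsto.mono_left (nhdsWithin_le_nhds (s := Set.Ioi (1 : ℝ)))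
        simpa using this
    · filter_upwards [Ioc_mem_nhdsGT (show (1 : ℝ) < 2 by norm_num)] with x hx n
      have hx0 : 0 < x - 1 := sub_pos.mpr hx.1
      rw [Real.norm_of_nonneg (mul_nonneg hx0.le
        (div_nonneg (residueClass_nonneg a n) (by positivity)))]
      rcases Nat.eq_zero_or_pos n with rfl | hn
      · simpa using add_nonneg (hA0 0) (hB0 0)
      have hn' : (0 : ℝ) < n := by exact_mod_cast hn
      have hpow : (n : ℝ) ^ x = n * (n : ℝ) ^ (x - 1) := by
        rw [Real.rpow_sub hn', Real.rpow_one]; field_simp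
      have h1 : 1 ≤ (n : ℝ) ^ (x - 1) :=
        Real.one_le_rpow (by exact_mod_cast hn) hx0.le
      by_cases hp : n.Prime
      · refine le_trans ?_ (le_add_of_nonneg_left (hA0 n))
        by_cases hr : (n : ZMod q) = a
        · have hBn : B n = (n : ℝ)⁻¹ :=
            Set.indicator_of_mem (show n ∈ {p : ℕ | p.Prime ∧ (p : ZMod q) = a} from ⟨hp, hr⟩) _
          have hres : residueClass a n = Real.log n := by
            rw [residueClass, Set.indicator_of_mem (show n ∈ {n : ℕ | (n : ZMod q) = a} from hr),
              vonMangoldt_apply_prime hp]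
          rw [hBn, hres, hpow]
          have h2 : (x - 1) * Real.log n ≤ (n : ℝ) ^ (x - 1) := by
            rw [Real.rpow_def_of_pos hn', mul_comm]
            linarith [Real.add_one_le_exp (Real.log n * (x - 1))]
          rw [← mul_div_assoc, div_le_iff₀ (by positivity)]
          field_simp
          exact h2
        · have hres : residueClass a n = 0 :=
            Set.indicator_of_notMem (show n ∉ {n : ℕ | (n : ZMod q) = a} from hr) _
          simpa [hres] using hB0 n
      · refine le_trans ?_ (le_add_of_nonneg_right (hB0 n))
        simp only [hA, hp, if_false]
        calc (x - 1) * (residueClass a n / (n : ℝ) ^ x)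
            ≤ 1 * (residueClass a n / (n : ℝ)) := by
              refine mul_le_mul (by linarith [hx.2]) ?_
                (div_nonneg (residueClass_nonneg a n) (by positivity)) zero_le_one
              refine div_le_div_of_nonneg_left (residueClass_nonneg a n) hn' ?_
              rw [hpow]
              exact le_mul_of_one_le_right hn'.le h1
          _ = _ := one_mul _
  rw [tsum_zero] at hlim
  have hlow : Tendsto (fun x : ℝ => (q.totient : ℝ)⁻¹ - C * (x - 1)) (𝓝[>] 1)
      (𝓝 (q.totient : ℝ)⁻¹) := by
    have hc : ContinuousAt (fun x : ℝ => (q.totient : ℝ)⁻¹ - C * (x - 1)) 1 := by fun_prop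
    have := hc.tendsto.mono_left (nhdsWithin_le_nhds (s := Set.Ioi (1 : ℝ)))
    simpa using this
  have hle : (q.totient : ℝ)⁻¹ ≤ 0 := by
    refine le_of_tendsto_of_tendsto hlow hlim ?_
    filter_upwards [Ioc_mem_nhdsGT (show (1 : ℝ) < 2 by norm_num)] with x hx
    have hx0 : 0 < x - 1 := sub_pos.mpr hx.1
    rw [tsum_mul_left]
    calc (q.totient : ℝ)⁻¹ - C * (x - 1) = (x - 1) * ((q.totient : ℝ)⁻¹ / (x - 1) - C) := by
          field_simp
      _ ≤ _ := mul_le_mul_of_nonneg_left (hC hx) hx0.le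
  have hq : 0 < (q.totient : ℝ)⁻¹ :=
    inv_pos.mpr (by exact_mod_cast Nat.totient_pos.mpr (NeZero.pos q))
  exact hle.not_gt hq

/-! ### Sieve by exact divisibility -/

theorem Nat.count_mul_of_periodic {A : ℕ → Prop} [DecidablePred A] {M : ℕ}
    (hA : Function.Periodic A M) (t : ℕ) : Nat.count A (M * t) = t * Nat.count A M := by
  induction t with
  | zero => simp
  | succ t ih =>
    rw [Nat.mul_succ, Nat.count_add, ih, Nat.succ_mul]
    congr 1
    rw [Nat.count_eq_card_filter_range, Nat.count_eq_card_filter_range]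
    congr 1
    refine Finset.filter_congr fun k _ => ?_
    have := hA.nat_mul t k
    rw [add_comm (M * t), mul_comm M t]
    exact iff_of_eq this

theorem Nat.count_and_of_periodic {A B : ℕ → Prop} [DecidablePred A] [DecidablePred B] {M K : ℕ}
    (hA : Function.Periodic A M) (hB : Function.Periodic B K) (hM : 0 < M) (hK : 0 < K)
    (hMK : M.Coprime K) :
    Nat.count (fun k => A k ∧ B k) (M * K) = Nat.count A M * Nat.count B K := by
  simp only [Nat.count_eq_card_filter_range]
  rw [← Finset.card_product]
  refine Finset.card_nbij' (fun x => (x % M, x % K))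
    (fun y => (Nat.chineseRemainder hMK y.1 y.2 : ℕ)) ?_ ?_ ?_ ?_
  · intro x hx
    simp only [Finset.coe_filter, Finset.mem_range, Set.mem_ofPred_eq] at hx
    simp only [Finset.coe_product, Finset.coe_filter, Finset.mem_range, Set.mem_prod,
      Set.mem_ofPred_eq, hA.map_mod_nat, hB.map_mod_nat]
    exact ⟨⟨Nat.mod_lt _ hM, hx.2.1⟩, ⟨Nat.mod_lt _ hK, hx.2.2⟩⟩
  · rintro ⟨u, v⟩ hx
    simp only [Finset.coe_product, Finset.coe_filter, Finset.mem_range, Set.mem_prod,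
      Set.mem_ofPred_eq] at hx
    have h := (Nat.chineseRemainder hMK u v).2
    simp only [Finset.coe_filter, Finset.mem_range, Set.mem_ofPred_eq]
    refine ⟨Nat.chineseRemainder_lt_mul hMK u v hM.ne' hK.ne', ?_, ?_⟩
    · rw [← hA.map_mod_nat, h.1, hA.map_mod_nat]; exact hx.1.2
    · rw [← hB.map_mod_nat, h.2, hB.map_mod_nat]; exact hx.2.2
  · intro x hx
    simp only [Finset.coe_filter, Finset.mem_range, Set.mem_ofPred_eq] at hx
    have h := Nat.chineseRemainder_modEq_unique hMK (a := x % M) (b := x % K) (z := x)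
      (Nat.mod_modEq x M).symm (Nat.mod_modEq x K).symm
    have h2 := Nat.chineseRemainder_lt_mul hMK (x % M) (x % K) hM.ne' hK.ne'
    exact (Nat.ModEq.eq_of_lt_of_lt h hx.1 h2).symm
  · rintro ⟨u, v⟩ hx
    simp only [Finset.coe_product, Finset.coe_filter, Finset.mem_range, Set.mem_prod,
      Set.mem_ofPred_eq] at hx
    have h := (Nat.chineseRemainder hMK u v).2
    exact Prod.ext (Nat.ModEq.eq_of_lt_of_lt ((Nat.mod_modEq _ _).trans h.1)
      (Nat.mod_lt _ hM) hx.1.1) (Nat.ModEq.eq_of_lt_of_lt ((Nat.mod_modEq _ _).trans h.2)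
      (Nat.mod_lt _ hK) hx.2.1)

/-- The prime `p` does not divide `c * k + d` exactly once. -/
def NotExactlyDvd (c d p k : ℕ) : Prop := p ∣ c * k + d → p ^ 2 ∣ c * k + d

instance (c d p : ℕ) : DecidablePred (NotExactlyDvd c d p) := fun _ =>
  inferInstanceAs (Decidable (_ → _))

theorem NotExactlyDvd.periodic (c d p : ℕ) : Function.Periodic (NotExactlyDvd c d p) (p ^ 2) := by
  intro k
  have h : c * (k + p ^ 2) + d = c * k + d + p * (p * c) := by ring
  have h' : c * (k + p ^ 2) + d = c * k + d + p ^ 2 * c := by ring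
  unfold NotExactlyDvd
  nth_rewrite 1 [h]
  rw [h', ← Nat.dvd_add_iff_left (dvd_mul_right _ _), ← Nat.dvd_add_iff_left (dvd_mul_right _ _)]

theorem NotExactlyDvd.count_add_le {c d p : ℕ} (hp : 0 < p) (hc : c.Coprime p) :
    Nat.count (NotExactlyDvd c d p) (p ^ 2) + (p - 1) ≤ p ^ 2 := by
  have hpos : 0 < p ^ 2 := by positivity
  have : NeZero (p ^ 2) := ⟨hpos.ne'⟩
  have hcp : c.Coprime (p ^ 2) := hc.pow_right 2
  have hcu : (c : ZMod (p ^ 2)) * (c : ZMod (p ^ 2))⁻¹ = 1 := ZMod.coe_mul_inv_eq_one c hcp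
  rw [Nat.count_eq_card_filter_range]
  have hsum := Finset.card_filter_add_card_filter_not (s := Finset.range (p ^ 2))
    (NotExactlyDvd c d p)
  rw [Finset.card_range] at hsum
  suffices h : p - 1 ≤ ((Finset.range (p ^ 2)).filter (fun k => ¬ NotExactlyDvd c d p k)).card from
    (Nat.add_le_add_left h _).trans_eq hsum
  rw [← Nat.card_Ico 1 p]
  -- f j solves c k + d ≡ j p modulo p²; for 0 < j < p this value is divisible by p exactly once.
  let f : ℕ → ℕ := fun j => (((j * p : ℕ) - (d : ZMod (p ^ 2))) * (c : ZMod (p ^ 2))⁻¹).val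
  have hf (j : ℕ) : c * f j + d ≡ j * p [MOD p ^ 2] := by
    rw [← ZMod.natCast_eq_natCast_iff, Nat.cast_add, Nat.cast_mul, ZMod.natCast_zmod_val]
    linear_combination ((j * p : ℕ) - (d : ZMod (p ^ 2))) * hcu
  have hlt {j : ℕ} (hj : j < p) : j * p < p ^ 2 := by
    rw [pow_two]; exact Nat.mul_lt_mul_of_pos_right hj hp
  refine Finset.card_le_card_of_injOn f ?_ ?_
  · intro j hj
    simp only [Finset.coe_Ico, Set.mem_Ico] at hj
    simp only [Finset.coe_filter, Finset.mem_range, Set.mem_ofPred_eq]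
    refine ⟨ZMod.val_lt _, fun h => ?_⟩
    have h1 : p ∣ c * f j + d :=
      (((hf j).of_dvd (dvd_pow_self p two_ne_zero)).dvd_iff dvd_rfl).mpr (dvd_mul_left p j)
    have h2 := ((hf j).dvd_iff dvd_rfl).mp (h h1)
    have := Nat.le_of_dvd (Nat.mul_pos hj.1 hp) h2
    exact absurd this (not_le.mpr (hlt hj.2))
  · intro i hi j hj hij
    simp only [Finset.coe_Ico, Set.mem_Ico] at hi hj
    have h := (hf i).symm.trans ((congrArg (fun t => c * t + d) hij : _ = _) ▸ hf j)
    exact Nat.eq_of_mul_eq_mul_right hp (Nat.ModEq.eq_of_lt_of_lt h (hlt hi.2) (hlt hj.2))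

theorem periodic_forall_notExactlyDvd (c d : ℕ) (S : Finset ℕ) :
    Function.Periodic (fun k => ∀ p ∈ S, NotExactlyDvd c d p k) (∏ p ∈ S, p ^ 2) := by
  intro k
  refine propext (forall₂_congr fun p hp => ?_)
  obtain ⟨t, ht⟩ := Finset.dvd_prod_of_mem (fun p => p ^ 2) hp
  rw [ht, mul_comm]
  exact iff_of_eq ((NotExactlyDvd.periodic c d p).nat_mul t k)

theorem count_forall_notExactlyDvd_le {c d : ℕ} (S : Finset ℕ)
    (hS : ∀ p ∈ S, p.Prime ∧ c.Coprime p) :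
    (Nat.count (fun k => ∀ p ∈ S, NotExactlyDvd c d p k) (∏ p ∈ S, p ^ 2) : ℝ) ≤
      (∏ p ∈ S, p ^ 2 : ℕ) * Real.exp (-(∑ p ∈ S, (p : ℝ)⁻¹) / 2) := by
  induction S using Finset.induction_on with
  | empty => simp
  | insert p S hpS ih =>
    have hp := (hS p (Finset.mem_insert_self p S)).1
    have hc := (hS p (Finset.mem_insert_self p S)).2
    have ih := ih fun r hr => hS r (Finset.mem_insert_of_mem hr)
    have hcop : (p ^ 2).Coprime (∏ p ∈ S, p ^ 2) := by
      refine Nat.Coprime.prod_right fun r hr => Nat.Coprime.pow 2 2 ?_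
      refine (Nat.coprime_primes hp (hS r (Finset.mem_insert_of_mem hr)).1).mpr ?_
      rintro rfl
      exact hpS hr
    have hpos : 0 < ∏ p ∈ S, p ^ 2 :=
      Finset.prod_pos fun r hr => pow_pos (hS r (Finset.mem_insert_of_mem hr)).1.pos 2
    rw [Finset.prod_insert hpS, Finset.sum_insert hpS]
    simp only [Finset.forall_mem_insert]
    rw [Nat.count_and_of_periodic (NotExactlyDvd.periodic c d p)
      (periodic_forall_notExactlyDvd c d S) (pow_pos hp.pos 2) hpos hcop]
    -- As p ≥ 2, 1 - (p - 1)/p² ≤ 1 - 1/(2p) ≤ exp(-1/(2p)).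
    have h1 : (Nat.count (NotExactlyDvd c d p) (p ^ 2) : ℝ) ≤
        (p : ℝ) ^ 2 * Real.exp (-(p : ℝ)⁻¹ / 2) := by
      have h2 := NotExactlyDvd.count_add_le (d := d) hp.pos hc
      have h3 : (Nat.count (NotExactlyDvd c d p) (p ^ 2) : ℝ) + (p - 1) ≤ (p : ℝ) ^ 2 := by
        rw [← Nat.cast_one, ← Nat.cast_sub hp.one_le]
        exact_mod_cast h2
      have hp2 : (2 : ℝ) ≤ p := by exact_mod_cast hp.two_le
      have h4 := Real.add_one_le_exp (-(p : ℝ)⁻¹ / 2)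
      have h5 : (p : ℝ) ^ 2 * (-(p : ℝ)⁻¹ / 2 + 1) = (p : ℝ) ^ 2 - p / 2 := by
        field_simp
        ring
      have h6 := mul_le_mul_of_nonneg_left h4 (show (0 : ℝ) ≤ (p : ℝ) ^ 2 by positivity)
      linarith
    push_cast at ih ⊢
    rw [neg_add, add_div, Real.exp_add, mul_mul_mul_comm]
    exact mul_le_mul h1 ih (by positivity) (by positivity)

/-- Discarding finitely many terms preserves divergence; this lets the sieve avoid the primes
dividing `c`. -/
theorem exists_finset_lt_sum_of_not_summable {f : ℕ → ℝ} {A : Set ℕ}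
    (hf : ∀ n, 0 ≤ f n) (h : ¬ Summable (A.indicator f)) (F : Finset ℕ) (C : ℝ) :
    ∃ S : Finset ℕ, (∀ p ∈ S, p ∈ A ∧ p ∉ F) ∧ C < ∑ p ∈ S, f p := by
  classical
  by_contra! hcon
  refine h (summable_of_sum_le (c := C + ∑ p ∈ F, f p)
    (Set.indicator_nonneg fun n _ => hf n) fun u => ?_)
  have h1 := hcon ((u \ F).filter (· ∈ A)) (by
    intro p hp
    simp only [Finset.mem_filter, Finset.mem_sdiff] at hp
    exact ⟨hp.2, hp.1.2⟩)
  have h2 : ∑ p ∈ u \ F, A.indicator f p = ∑ p ∈ (u \ F).filter (· ∈ A), f p := by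
    rw [Finset.sum_filter]
    rfl
  calc ∑ p ∈ u, A.indicator f p
      ≤ ∑ p ∈ u \ F, A.indicator f p + ∑ p ∈ F, A.indicator f p := by
        rw [← Finset.sum_union Finset.sdiff_disjoint, Finset.sdiff_union_self_eq_union]
        exact Finset.sum_le_sum_of_subset_of_nonneg Finset.subset_union_left
          fun n _ _ => Set.indicator_nonneg (fun n _ => hf n) n
    _ ≤ _ := add_le_add (h2.trans_le h1)
        (Finset.sum_le_sum fun n _ => Set.indicator_le_self' (fun _ _ => hf n) n)

/-- Sieving by exact divisibility of `c * k + d` by primes in a residue class leaves a set of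
density zero. -/
theorem tendsto_card_div_of_forall_notExactlyDvd {c d q : ℕ} [NeZero q] (hc0 : c ≠ 0)
    {a : ZMod q} (ha : IsUnit a) (A : ℕ → Prop) [DecidablePred A]
    (hA : ∀ k, A k → ∀ p : ℕ, p.Prime → (p : ZMod q) = a → NotExactlyDvd c d p k) :
    Tendsto (fun n : ℕ => (((Finset.Icc 1 n).filter A).card : ℝ) / n) atTop (𝓝 0) := by
  rw [Metric.tendsto_atTop]
  intro ε hε
  -- The bound -2 log(ε/2) makes exp(-∑ 1/p / 2) < ε/2, so the sieved density is below ε/2.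
  obtain ⟨S, hS, hsum⟩ := exists_finset_lt_sum_of_not_summable (fun n => by positivity)
    (not_summable_inv_primes_residueClass ha) c.primeFactors (-2 * Real.log (ε / 2))
  have hS' : ∀ p ∈ S, p.Prime ∧ c.Coprime p := by
    intro p hp
    obtain ⟨⟨h1, -⟩, h2⟩ := hS p hp
    refine ⟨h1, ((Nat.Prime.coprime_iff_not_dvd h1).mpr fun h => h2 ?_).symm⟩
    exact Nat.mem_primeFactors.mpr ⟨h1, h, hc0⟩
  set M := ∏ p ∈ S, p ^ 2 with hM
  set D := Nat.count (fun k => ∀ p ∈ S, NotExactlyDvd c d p k) M with hD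
  have hMpos : 0 < M := Finset.prod_pos fun p hp => pow_pos (hS' p hp).1.pos 2
  have hMpos' : (0 : ℝ) < M := by exact_mod_cast hMpos
  have hDM : (D : ℝ) < M * (ε / 2) := by
    refine (count_forall_notExactlyDvd_le S hS').trans_lt (mul_lt_mul_of_pos_left ?_ hMpos')
    rw [← Real.lt_log_iff_exp_lt (by positivity)]
    linarith
  -- Past 2D/ε, the one extra period needed to cover [1, n] costs D < nε/2.
  refine ⟨⌈2 * D / ε⌉₊ + 1, fun n hn => ?_⟩
  have hn1 : 2 * D / ε < n := by
    refine (Nat.le_ceil _).trans_lt ?_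
    exact_mod_cast hn
  have hnpos : (0 : ℝ) < n := lt_of_le_of_lt (by positivity) hn1
  have hcard : ((Finset.Icc 1 n).filter A).card ≤ (n / M + 1) * D := by
    rw [hD, ← Nat.count_mul_of_periodic (periodic_forall_notExactlyDvd c d S),
      Nat.count_eq_card_filter_range]
    refine Finset.card_le_card fun k hk => ?_
    simp only [Finset.mem_filter, Finset.mem_Icc, Finset.mem_range] at hk ⊢
    refine ⟨hk.1.2.trans_lt (Nat.lt_mul_div_succ n hMpos), fun p hp => ?_⟩
    exact hA k hk.2 p (hS p hp).1.1 (hS p hp).1.2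
  have hcard' : (((Finset.Icc 1 n).filter A).card : ℝ) ≤ (n / M + 1) * D := by
    refine (Nat.cast_le.mpr hcard).trans ?_
    push_cast
    gcongr
    exact Nat.cast_div_le
  rw [Real.dist_eq, sub_zero, abs_of_nonneg (by positivity), div_lt_iff₀ hnpos]
  refine hcard'.trans_lt ?_
  have h1 : (n : ℝ) / M * D < n * (ε / 2) := by
    rw [div_mul_eq_mul_div, div_lt_iff₀ hMpos', mul_assoc]
    rw [mul_comm (ε / 2)]
    exact mul_lt_mul_of_pos_left hDM hnpos
  have h2 : (D : ℝ) < n * (ε / 2) := by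
    rw [div_lt_iff₀ hε] at hn1
    linarith
  linarith

/-! ### Conclusion -/

theorem notExactlyDvd_of_odd_cp {k p : ℕ} (hk : Odd (cp 3 1 4 k)) (hp : p.Prime)
    (hp4 : p % 4 = 3) : NotExactlyDvd 24 5 p k := by
  intro hd
  have h1 := even_factorization_of_odd_cp hk hp hp4
  have h2 := (hp.dvd_iff_one_le_factorization (by omega)).mp hd
  refine (hp.pow_dvd_iff_le_factorization (by omega)).mpr ?_
  obtain ⟨t, ht⟩ := h1
  omega

theorem mainTheorem1 :
    Tendsto
        (fun n : ℕ => (((Finset.Icc 1 n).filter (fun k => Even (cp 3 1 4 k))).card : ℝ) / (n : ℝ))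
        atTop (𝓝 1) ∧
      ∀ n : ℕ,
        (∃ p : ℕ, p.Prime ∧ p % 4 = 3 ∧ Odd ((24 * n + 5).factorization p)) →
          Even (cp 3 1 4 n) := by
  constructor
  · have h := tendsto_card_div_of_forall_notExactlyDvd (c := 24) (d := 5) (q := 4) (a := 3)
      (by norm_num) (by decide) (fun k => ¬ Even (cp 3 1 4 k)) (by
        intro k hk p hp hp4
        refine notExactlyDvd_of_odd_cp (Nat.not_even_iff_odd.mp hk) hp ?_
        exact (ZMod.natCast_eq_natCast_iff' p 3 4).mp (by exact_mod_cast hp4))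
    have h1 := h.const_sub 1
    rw [sub_zero] at h1
    refine h1.congr' ?_
    filter_upwards [eventually_gt_atTop 0] with n hn
    have hn' : (n : ℝ) ≠ 0 := by positivity
    have hsum := Finset.card_filter_add_card_filter_not (s := Finset.Icc 1 n)
      (fun k => Even (cp 3 1 4 k))
    rw [Nat.card_Icc, Nat.add_sub_cancel] at hsum
    rw [eq_div_iff hn', sub_mul, div_mul_cancel₀ _ hn', one_mul, sub_eq_iff_eq_add]
    exact_mod_cast hsum.symm
  · rintro n ⟨p, hp, hp4, hodd⟩
    by_contra hne
    exact Nat.not_even_iff_odd.mpr hodd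
      (even_factorization_of_odd_cp (Nat.not_even_iff_odd.mp hne) hp hp4)
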